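/- Let $I_{\max}>0$ and let $\mathcal I=\{x\in\mathbb R^2:\|x\|_2\le I_{\max}\}$ be the set of safe currents. For $i=1,2$ let $q_i,\zeta_i\in\mathbb R$ and $a_i\in\mathbb R^2$ with $a_1,a_2$ linearly independent, and put $\mathbf M_i=\begin{bmatrix} q_i\mathbf I_2&\frac12 a_i\\ \frac12a_i^\top&\zeta_i\end{bmatrix}$, so that $\operatorname{Tr}(\mathbf M_i\mathbf W(x))=q_i\|x\|_2^2+a_i^\top x+\zeta_i$ for $\mathbf W(x)=\begin{bmatrix}x\\1\end{bmatrix}\begin{bmatrix}x^\top&1\end{bmatrix}$ (for instance two of the active power, the reactive power and the squared voltage of a converter behind a nondegenerate impedance, as functions of its current $x=\mathbf I_{\mathrm{dq}}$). Let $$\mathcal W=\{\mathbf W\in\mathbb S^3_+ : W_{11}+W_{22}\le I_{\max}^2,\ W_{33}=1\},$$ and let $f_0$ be convex and differentiable with $L$-Lipschitz gradient on $\{(\operatorname{Tr}(\mathbf M_1\mathbf W),\operatorname{Tr}(\mathbf M_2\mathbf W)):\mathbf W\in\mathcal W\}\subset\mathbb R^2$. For $\rho>0$ put $f(\mathbf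 W)=f_0(\operatorname{Tr}(\mathbf M_1\mathbf W),\operatorname{Tr}(\mathbf M_2\mathbf W))+\rho\operatorname{Tr}(\mathbf W)$ and $\nabla f(\mathbf W)=\partial_1f_0\,\mathbf M_1+\partial_2f_0\,\mathbf M_2+\rho\mathbf I_3$, the partial derivatives being taken at $(\operatorname{Tr}(\mathbf M_1\mathbf W),\operatorname{Tr}(\mathbf M_2\mathbf W))$. One step $x\mapsto y$ of the algorithm with step size $\alpha>0$ is as follows. (1) Let $\mathbf V$ be the point of $\mathcal W$ nearest, in the Frobenius norm, to $\mathbf W(x)-\alpha\nabla f(\mathbf W(x))$. (2) Put $s_i=\operatorname{Tr}(\mathbf M_i\mathbf V)$, let $\mathbf P$ be the matrix with rows $a_1^\top,a_2^\top$, and let $c=\mathbf P^{-1}(q_1,q_2)^\top$, $d=\mathbf P^{-1}(s_1-\zeta_1,s_2-\zeta_2)^\top$; let $\mu_1$ be the smallest root of $\|c\|_2^2\mu^2-(2d^\top c+1)\mu+\|d\|_2^2=0$ and set $y=d-\mu_1c$ (the current of smallest magnitude with outputs $s_1,s_2$). Then there is $\alpha_0>0$ such that for every $\rho>0$ there is a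 current $x^*\in\mathcal I$ such that $\mathbf W(x^*)$ minimizes $f$ over $\mathcal W$ (hence $x^*$ minimizes $f(\mathbf W(x))$ over $x\in\mathcal I$) and, for every $\alpha\in(0,\alpha_0)$: 1. for every $x^0\in\mathcal I$ the algorithm started at $x^0$ is well defined, that is, it generates exactly one sequence $(x^k)_{k\ge0}$; 2. every such sequence satisfies $x^k\in\mathcal I$ for all $k$ and $x^k\to x^*$; 3. $x^*$ is an asymptotically stable equilibrium of the algorithm on $\mathcal I$: it is a fixed point of the step; for every $\varepsilon>0$ there is $\delta>0$ such that $x^0\in\mathcal I$ and $\|x^0-x^*\|_2<\delta$ imply $\|x^k-x^*\|_2<\varepsilon$ for all $k$; and all sequences starting in $\mathcal I$ sufficiently close to $x^*$ converge to $x^*$. -/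

import Mathlib

namespace SafeConverter

open scoped Matrix

/-- A current `I_dq` (or a pair of outputs `(S₁, S₂)`): the plane with its Euclidean norm. -/
abbrev Plane : Type := EuclideanSpace ℝ (Fin 2)

abbrev Mat3 : Type := Matrix (Fin 3) (Fin 3) ℝ

/-- The safe operating region `𝓘`: all currents of magnitude at most `Imax`. -/
def safeSet (Imax : ℝ) : Set Plane := {x | ‖x‖ ^ 2 ≤ Imax ^ 2}

/-- The coefficients of a quadratic output `x ↦ q ‖x‖² + aᵀ x + ζ` of the current `x`.
With impedance `Z = [[R, -ωL], [ωL, R]]`, grid voltage `e = (E, 0)` and `J = [[0, 1], [-1, 0]]`: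
* active power: `q = 3/2 R`, `a = 3/2 e`, `ζ = 0`;
* reactive power: `q = 3/2 ωL`, `a = 3/2 J e`, `ζ = 0`;
* squared voltage: `q = R² + (ωL)²`, `a = 2 Zᵀ e`, `ζ = E²`. -/
structure Output where
  q : ℝ
  a : Fin 2 → ℝ
  ζ : ℝ

/-- The symmetric matrix `[[q I₂, a/2], [aᵀ/2, ζ]]`. -/
noncomputable def Output.mat (S : Output) : Mat3 :=
  !![S.q, 0, S.a 0 / 2;
     0, S.q, S.a 1 / 2;
     S.a 0 / 2, S.a 1 / 2, S.ζ]

/-- The feasible set `𝓦` of the semidefinite program. -/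
def feasible (Imax : ℝ) : Set Mat3 :=
  {W | W.PosSemidef ∧ W 0 0 + W 1 1 ≤ Imax ^ 2 ∧ W 2 2 = 1}

/-- The rank-one matrix `(x, 1)(x, 1)ᵀ` that represents the current `x`. -/
def lift (x : Plane) : Mat3 := Matrix.vecMulVec ![x 0, x 1, 1] ![x 0, x 1, 1]

/-- The pair `(Tr (M₁ W), Tr (M₂ W))`. -/
noncomputable def outputs (S₁ S₂ : Output) (W : Mat3) : Plane :=
  !₂[(S₁.mat * W).trace, (S₂.mat * W).trace]

/-- The set of all pairs `(Tr (M₁ W), Tr (M₂ W))` with `W ∈ 𝓦`. -/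
def outputRegion (Imax : ℝ) (S₁ S₂ : Output) : Set Plane :=
  outputs S₁ S₂ '' feasible Imax

/-- `f₀` is convex and differentiable with `L`-Lipschitz gradient on the set `D`. -/
def IsConvexSmooth (L : NNReal) (D : Set Plane) (f₀ : Plane → ℝ) : Prop :=
  ConvexOn ℝ D f₀ ∧ DifferentiableOn ℝ f₀ D ∧ LipschitzOnWith L (gradientWithin f₀ D) D

/-- `f(W) = f₀(Tr (M₁ W), Tr (M₂ W)) + ρ Tr W`. -/
noncomputable def objective (S₁ S₂ : Output) (f₀ : Plane → ℝ) (ρ : ℝ) (W : Mat3) : ℝ :=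
  f₀ (outputs S₁ S₂ W) + ρ * W.trace

/-- `∇f(W) = ∂₁f₀ M₁ + ∂₂f₀ M₂ + ρ I₃`, the partial derivatives being taken at
`(Tr (M₁ W), Tr (M₂ W))`. -/
noncomputable def gradObjective (Imax : ℝ) (S₁ S₂ : Output) (f₀ : Plane → ℝ) (ρ : ℝ)
    (W : Mat3) : Mat3 :=
  let g : Plane := gradientWithin f₀ (outputRegion Imax S₁ S₂) (outputs S₁ S₂ W)
  g 0 • S₁.mat + g 1 • S₂.mat + ρ • (1 : Mat3)

section Projection

attribute [local instance] Matrix.frobeniusNormedAddCommGroup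

/-- `V` is a nearest point to `Y` in `𝓦` for the Frobenius norm. -/
def IsProjection (Imax : ℝ) (Y V : Mat3) : Prop :=
  V ∈ feasible Imax ∧ ∀ W ∈ feasible Imax, ‖V - Y‖ ≤ ‖W - Y‖

end Projection

/-- The matrix `P` with rows `aᵀ` and `bᵀ`. -/
def rowMat (S₁ S₂ : Output) : Matrix (Fin 2) (Fin 2) ℝ := Matrix.of ![S₁.a, S₂.a]

/-- `c = P⁻¹ (q₁, q₂)`. -/
noncomputable def vecC (S₁ S₂ : Output) : Fin 2 → ℝ := (rowMat S₁ S₂)⁻¹ *ᵥ ![S₁.q, S₂.q]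

/-- `d = P⁻¹ (s₁ - ζ₁, s₂ - ζ₂)`, so that a current `x` has outputs `s` if and only if
`x = d - ‖x‖² c`. -/
noncomputable def vecD (S₁ S₂ : Output) (s : Plane) : Fin 2 → ℝ :=
  (rowMat S₁ S₂)⁻¹ *ᵥ ![s 0 - S₁.ζ, s 1 - S₂.ζ]

/-- The roots `μ` of `‖c‖² μ² - (2 dᵀc + 1) μ + ‖d‖² = 0`. -/
def magnitudeRoots (S₁ S₂ : Output) (s : Plane) : Set ℝ :=
  {μ | (vecC S₁ S₂ ⬝ᵥ vecC S₁ S₂) * μ ^ 2 - (2 * (vecD S₁ S₂ s ⬝ᵥ vecC S₁ S₂) + 1) * μ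
    + vecD S₁ S₂ s ⬝ᵥ vecD S₁ S₂ s = 0}

/-- `y = d - μ₁ c`, where `μ₁` is the smallest root: the extraction of a current from `V`. -/
def IsExtraction (S₁ S₂ : Output) (V : Mat3) (y : Plane) : Prop :=
  ∃ μ₁ : ℝ, IsLeast (magnitudeRoots S₁ S₂ (outputs S₁ S₂ V)) μ₁ ∧
    y = WithLp.toLp 2 (vecD S₁ S₂ (outputs S₁ S₂ V) - μ₁ • vecC S₁ S₂)

/-- One iteration `x ↦ y` of the algorithm: lift `x`, take a projected gradient step of size `α`
in `𝓦`, and extract the current `y` from the result. -/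
def IsStep (Imax : ℝ) (S₁ S₂ : Output) (f₀ : Plane → ℝ) (ρ α : ℝ) (x y : Plane) : Prop :=
  ∃ V : Mat3,
    IsProjection Imax (lift x - α • gradObjective Imax S₁ S₂ f₀ ρ (lift x)) V ∧
    IsExtraction S₁ S₂ V y

/-- `x` is an infinite trajectory of the relation `step` from `x₀`. -/
def IsRun (step : Plane → Plane → Prop) (x₀ : Plane) (x : ℕ → Plane) : Prop :=
  x 0 = x₀ ∧ ∀ k, step (x k) (x (k + 1))

/-- `z` is an asymptotically stable equilibrium of `step` on the state space `X`:
an equilibrium that is Lyapunov stable and attracts all trajectories starting near it. -/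
def IsAsymptoticallyStable (X : Set Plane) (step : Plane → Plane → Prop) (z : Plane) : Prop :=
  step z z ∧
  (∀ ε > 0, ∃ δ > 0, ∀ x₀ ∈ X, dist x₀ z < δ →
    ∀ x, IsRun step x₀ x → ∀ k, dist (x k) z < ε) ∧
  (∃ δ > 0, ∀ x₀ ∈ X, dist x₀ z < δ →
    ∀ x, IsRun step x₀ x → Filter.Tendsto x Filter.atTop (nhds z))

end SafeConverter

namespace SafeConverter

open scoped Matrix

/-! Let `V` be feasible with last column `(m, 1)` and `t = V 0 0 + V 1 1`, so that `‖m‖² ≤ t`. Its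
outputs give `d = m + t c`, and the roots `μ` are the solutions of `‖d - μ c‖² = μ`. At `μ = 0` the
left side is at least the right, at `μ = t` at most, so the smallest root is at most `t`. The
extracted current therefore keeps the outputs and does not increase the trace
(`IsExtraction.norm_sq_le`): it is safe, and as `ρ > 0` it does not increase the objective, with
equality only if `V` already has rank one (`IsExtraction.eq_lift`).

Hence the relaxation is tight and its rank-one minimizer is unique (`eq_of_isMinOn_lift`). A step is
a projected gradient step followed by a further non-increase, so for `α S < 1`, with `S` the
`smoothness`, the objective decreases along runs to its minimum (`IsStep.objective_bounds`,
`tendsto_of_descent_bounds`). Compactness and uniqueness turn convergence of values into convergence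
of currents; monotonicity gives Lyapunov stability. -/

/-! ### Frobenius geometry of 3 × 3 matrices -/

/-- The Frobenius inner product of two matrices. -/
def frobInner (A B : Mat3) : ℝ := ∑ i, ∑ j, A i j * B i j

theorem frobInner_comm (A B : Mat3) : frobInner A B = frobInner B A := by
  simp [frobInner, mul_comm]

theorem frobInner_add_left (A B C : Mat3) :
    frobInner (A + B) C = frobInner A C + frobInner B C := by
  simp [frobInner, add_mul, Finset.sum_add_distrib]

theorem frobInner_smul_left (r : ℝ) (A C : Mat3) :
    frobInner (r • A) C = r * frobInner A C := by
  simp [frobInner, mul_assoc, Finset.mul_sum]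

theorem frobInner_sub_left (A B C : Mat3) :
    frobInner (A - B) C = frobInner A C - frobInner B C := by
  simp [frobInner, sub_mul, Finset.sum_sub_distrib]

theorem frobInner_add_right (A B C : Mat3) :
    frobInner A (B + C) = frobInner A B + frobInner A C := by
  simp [frobInner, mul_add, Finset.sum_add_distrib]

theorem frobInner_smul_right (r : ℝ) (A C : Mat3) :
    frobInner A (r • C) = r * frobInner A C := by
  simp [frobInner, mul_left_comm, Finset.mul_sum]

theorem frobInner_sub_right (A B C : Mat3) :
    frobInner A (B - C) = frobInner A B - frobInner A C := by
  simp [frobInner, mul_sub, Finset.sum_sub_distrib]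

theorem frobInner_self_nonneg (A : Mat3) : 0 ≤ frobInner A A :=
  Finset.sum_nonneg fun _ _ => Finset.sum_nonneg fun _ _ => mul_self_nonneg _

theorem frobInner_self_eq_zero {A : Mat3} (h : frobInner A A = 0) : A = 0 := by
  ext i j
  have hrow : ∑ j, A i j * A i j = 0 :=
    (Finset.sum_eq_zero_iff_of_nonneg
      fun _ _ => Finset.sum_nonneg fun _ _ => mul_self_nonneg _).1 h i (Finset.mem_univ i)
  exact mul_self_eq_zero.1
    ((Finset.sum_eq_zero_iff_of_nonneg fun _ _ => mul_self_nonneg _).1 hrow j (Finset.mem_univ j))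

theorem continuous_frobInner_self_sub (Y : Mat3) :
    Continuous fun W : Mat3 => frobInner (W - Y) (W - Y) := by
  unfold frobInner
  fun_prop

/-- Cauchy-Schwarz for the Frobenius inner product. -/
theorem frobInner_sq_le (A B : Mat3) :
    frobInner A B ^ 2 ≤ frobInner A A * frobInner B B := by
  have key : ∀ t : ℝ, 0 ≤ frobInner A A * (t * t) + 2 * frobInner A B * t + frobInner B B := by
    intro t
    have := frobInner_self_nonneg (t • A + B)
    simp only [frobInner_add_left, frobInner_add_right, frobInner_smul_left,
      frobInner_smul_right, frobInner_comm B A] at this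
    linarith
  have := discrim_le_zero key
  rw [discrim] at this
  nlinarith

section

attribute [local instance] Matrix.frobeniusNormedAddCommGroup

theorem frobenius_norm_eq_sqrt (A : Mat3) : ‖A‖ = √(frobInner A A) := by
  rw [Matrix.frobenius_norm_def, ← Real.sqrt_eq_rpow]
  simp [frobInner, ← pow_two]

end

theorem isProjection_iff {Imax : ℝ} {Y V : Mat3} :
    IsProjection Imax Y V ↔ V ∈ feasible Imax ∧
      ∀ W ∈ feasible Imax, frobInner (V - Y) (V - Y) ≤ frobInner (W - Y) (W - Y) := by
  unfold IsProjection
  simp only [frobenius_norm_eq_sqrt]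
  refine and_congr_right fun _ => forall₂_congr fun W _ => ?_
  exact Real.sqrt_le_sqrt_iff (frobInner_self_nonneg _)

/-! ### The feasible set -/

theorem feasible_symm {Imax : ℝ} {W : Mat3} (hW : W ∈ feasible Imax) (i j : Fin 3) :
    W i j = W j i := by
  have := hW.1.isHermitian.apply j i
  simpa using this

/-- Positivity on the vector `(a, b, c)` in scalar form; the entrywise estimates come from concrete
choices of this vector. -/
theorem feasible_quadratic_nonneg {Imax : ℝ} {W : Mat3} (hW : W ∈ feasible Imax) (a b c : ℝ) :
    0 ≤ W 0 0 * a ^ 2 + W 1 1 * b ^ 2 + c ^ 2 + 2 * W 0 1 * a * b + 2 * W 0 2 * a * c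
      + 2 * W 1 2 * b * c := by
  have h := hW.1.dotProduct_mulVec_nonneg ![a, b, c]
  simp only [dotProduct, Matrix.mulVec, Fin.sum_univ_three] at h
  simp [feasible_symm hW 1 0, feasible_symm hW 2 0, feasible_symm hW 2 1, hW.2.2] at h
  linarith

theorem feasible_convex (Imax : ℝ) : Convex ℝ (feasible Imax) := by
  intro A hA B hB a b ha hb hab
  refine ⟨(hA.1.smul ha).add (hB.1.smul hb), ?_, ?_⟩
  · have h1 := mul_le_mul_of_nonneg_left hA.2.1 ha
    have h2 := mul_le_mul_of_nonneg_left hB.2.1 hb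
    have h3 : a * Imax ^ 2 + b * Imax ^ 2 = Imax ^ 2 := by rw [← add_mul, hab, one_mul]
    simp only [Matrix.add_apply, Matrix.smul_apply, smul_eq_mul]
    linarith
  · simp [hA.2.2, hB.2.2, hab]

theorem feasible_isClosed (Imax : ℝ) : IsClosed (feasible Imax) := by
  have h : feasible Imax = {W : Mat3 | Wᴴ = W} ∩ (⋂ v : Fin 3 → ℝ, {W | 0 ≤ star v ⬝ᵥ W *ᵥ v}) ∩
      ({W | W 0 0 + W 1 1 ≤ Imax ^ 2} ∩ {W | W 2 2 = 1}) := by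
    ext W
    simp [feasible, Matrix.posSemidef_iff_dotProduct_mulVec, Matrix.IsHermitian]
  rw [h]
  refine ((isClosed_eq (by fun_prop) (by fun_prop)).inter (isClosed_iInter fun v => ?_)).inter
    ((isClosed_le (by fun_prop) (by fun_prop)).inter (isClosed_eq (by fun_prop) (by fun_prop)))
  exact isClosed_le (by fun_prop) (by fun_prop)

theorem feasible_isCompact (Imax : ℝ) : IsCompact (feasible Imax) := by
  have hK : IsCompact (Set.univ.pi fun _ : Fin 3 => Set.univ.pi fun _ : Fin 3 =>
      Set.Icc (-(Imax ^ 2 + 1)) (Imax ^ 2 + 1)) :=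
    isCompact_univ_pi fun _ => isCompact_univ_pi fun _ => isCompact_Icc
  refine hK.of_isClosed_subset (feasible_isClosed Imax) fun W hW i _ j _ => ?_
  -- Unit vectors make the diagonal nonnegative; sums and differences of two of them bound `2 |W i
  -- j|` by `W i i + W j j`.
  have hq := feasible_quadratic_nonneg hW
  have h0 := hq 1 0 0
  have h1 := hq 0 1 0
  have h01 := hq 1 1 0
  have h01' := hq 1 (-1) 0
  have h02 := hq 1 0 1
  have h02' := hq 1 0 (-1)
  have h12 := hq 0 1 1
  have h12' := hq 0 1 (-1)
  have ht := hW.2.1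
  have h22 := hW.2.2
  have s0 := feasible_symm hW 1 0
  have s1 := feasible_symm hW 2 0
  have s2 := feasible_symm hW 2 1
  rw [Set.mem_Icc]
  fin_cases i <;> fin_cases j <;> simp <;> constructor <;> nlinarith

theorem lift_mem_feasible {Imax : ℝ} {x : Plane} (hx : x ∈ safeSet Imax) :
    lift x ∈ feasible Imax := by
  refine ⟨?_, ?_, ?_⟩
  · have := Matrix.posSemidef_vecMulVec_self_star (![x 0, x 1, 1] : Fin 3 → ℝ)
    simpa [lift] using this
  · have h : ‖x‖ ^ 2 ≤ Imax ^ 2 := hx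
    rw [EuclideanSpace.real_norm_sq_eq, Fin.sum_univ_two] at h
    simpa [lift, Matrix.vecMulVec_apply, ← pow_two] using h
  · simp [lift, Matrix.vecMulVec_apply]

theorem lift_eq (x : Plane) : lift x =
    !![x 0 ^ 2, x 0 * x 1, x 0; x 0 * x 1, x 1 ^ 2, x 1; x 0, x 1, 1] := by
  ext i j
  fin_cases i <;> fin_cases j <;> simp [lift, Matrix.vecMulVec_apply] <;> ring

theorem continuous_lift : Continuous lift := by
  unfold lift
  refine continuous_matrix fun i j => ?_
  simp only [Matrix.vecMulVec_apply]
  fin_cases i <;> fin_cases j <;> simp <;> fun_prop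

/-- If the trace of the leading block equals `‖m‖²`, with `m` the first two entries of the last
column, then a feasible matrix has rank one. -/
theorem feasible_eq_lift {Imax : ℝ} {V : Mat3} (hV : V ∈ feasible Imax) {y : Plane}
    (h0 : y 0 = V 0 2) (h1 : y 1 = V 1 2) (ht : V 0 0 + V 1 1 = y 0 ^ 2 + y 1 ^ 2) :
    V = lift y := by
  have hq := feasible_quadratic_nonneg hV
  -- With `c = -(a y₀ + b y₁)` the form becomes that of the Schur complement `A - y yᵀ`, where `A`
  -- is the leading block. It is positive semidefinite with trace zero, hence zero.
  have a0 := hq 1 0 (-y 0)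
  have a1 := hq 0 1 (-y 1)
  have b0 := hq 1 1 (-(y 0 + y 1))
  have b1 := hq 1 (-1) (-(y 0 - y 1))
  have s0 := feasible_symm hV 1 0
  have s1 := feasible_symm hV 2 0
  have s2 := feasible_symm hV 2 1
  have h22 := hV.2.2
  rw [← h0, ← h1] at a0 a1 b0 b1
  have e0 : V 0 0 = y 0 ^ 2 := by nlinarith
  have e1 : V 1 1 = y 1 ^ 2 := by nlinarith
  have e01 : V 0 1 = y 0 * y 1 := by
    rw [e0, e1] at b0 b1
    nlinarith
  rw [lift_eq]
  ext i j
  fin_cases i <;> fin_cases j <;> simp_all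

/-! ### Projection onto the feasible set -/

theorem exists_isProjection {Imax : ℝ} (Y : Mat3) : ∃ V, IsProjection Imax Y V := by
  have hne : (feasible Imax).Nonempty :=
    ⟨lift 0, lift_mem_feasible (by simp [safeSet, sq_nonneg])⟩
  obtain ⟨V, hV, hmin⟩ := (feasible_isCompact Imax).exists_isMinOn hne
    (continuous_frobInner_self_sub Y).continuousOn
  exact ⟨V, isProjection_iff.2 ⟨hV, hmin⟩⟩

/-- The variational inequality that characterizes the projection. -/
theorem IsProjection.frobInner_nonneg {Imax : ℝ} {Y V W : Mat3} (h : IsProjection Imax Y V)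
    (hW : W ∈ feasible Imax) : 0 ≤ frobInner (V - Y) (W - V) := by
  rw [isProjection_iff] at h
  by_contra! hneg
  set p := frobInner (V - Y) (W - V) with hp
  set n := frobInner (W - V) (W - V) with hn
  have hn0 : 0 ≤ n := frobInner_self_nonneg _
  -- `V` is compared with the point at parameter `t` on the segment to `W`, and the inequality is
  -- divided by `t`.
  have key : ∀ t : ℝ, 0 < t → t ≤ 1 → 0 ≤ 2 * p + t * n := by
    intro t ht0 ht1
    have hmem : (1 - t) • V + t • W ∈ feasible Imax :=
      feasible_convex Imax h.1 hW (by linarith) ht0.le (by ring)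
    have hle := h.2 _ hmem
    have he : (1 - t) • V + t • W - Y = (V - Y) + t • (W - V) := by module
    rw [he, frobInner_add_left, frobInner_add_right, frobInner_add_right, frobInner_smul_left,
      frobInner_smul_left, frobInner_smul_right, frobInner_smul_right,
      frobInner_comm (W - V) (V - Y), ← hp, ← hn] at hle
    have : 0 ≤ t * (2 * p + t * n) := by linarith
    exact nonneg_of_mul_nonneg_right this ht0
  have hpn : 0 < n - p := by linarith
  -- This parameter lies in `(0, 1]` even when `n = 0`, and `t n ≤ -p` makes `2 p + t n ≤ p < 0`.
  have h2 := key (-p / (n - p)) (by apply div_pos <;> linarith)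
    (by rw [div_le_one hpn]; linarith)
  have h3 : -p / (n - p) * n ≤ -p := by
    rw [div_mul_eq_mul_div, div_le_iff₀ hpn]
    nlinarith
  linarith

/-- The variational inequalities of the two points, each tested at the other, add up to `-‖V - V'‖²
≥ 0`. -/
theorem IsProjection.unique {Imax : ℝ} {Y V V' : Mat3} (h : IsProjection Imax Y V)
    (h' : IsProjection Imax Y V') : V = V' := by
  have h1 := h.frobInner_nonneg h'.1
  have h2 := h'.frobInner_nonneg h.1
  have hz : frobInner (V - V') (V - V') = 0 := by
    refine le_antisymm ?_ (frobInner_self_nonneg _)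
    simp only [frobInner_sub_left, frobInner_sub_right] at h1 h2 ⊢
    linarith
  exact sub_eq_zero.1 (frobInner_self_eq_zero hz)

/-! ### Outputs and extraction -/

theorem frobInner_mat (S : Output) (W : Mat3) : frobInner S.mat W = (S.mat * W).trace := by
  simp only [frobInner, Matrix.trace, Matrix.diag_apply, Matrix.mul_apply, Fin.sum_univ_three]
  simp [Output.mat]
  ring

theorem frobInner_one (W : Mat3) : frobInner 1 W = W.trace := by
  simp [frobInner, Matrix.trace, Fin.sum_univ_three, Matrix.one_apply]

theorem outputs_zero_eq (S₁ S₂ : Output) (W : Mat3) :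
    outputs S₁ S₂ W 0 = frobInner S₁.mat W := by
  simp [outputs, frobInner_mat]

theorem outputs_one_eq (S₁ S₂ : Output) (W : Mat3) :
    outputs S₁ S₂ W 1 = frobInner S₂.mat W := by
  simp [outputs, frobInner_mat]

theorem plane_ext {x y : Plane} (h0 : x 0 = y 0) (h1 : x 1 = y 1) : x = y := by
  ext i
  fin_cases i
  · exact h0
  · exact h1

theorem plane_norm_sq (x : Plane) : ‖x‖ ^ 2 = x 0 ^ 2 + x 1 ^ 2 := by
  rw [EuclideanSpace.real_norm_sq_eq, Fin.sum_univ_two]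

theorem plane_inner (x y : Plane) : inner ℝ x y = x 0 * y 0 + x 1 * y 1 := by
  simp [PiLp.inner_apply, Fin.sum_univ_two, mul_comm]

theorem frobInner_mat_of_feasible {Imax : ℝ} (S : Output) {V : Mat3} (hV : V ∈ feasible Imax) :
    frobInner S.mat V = S.q * (V 0 0 + V 1 1) + (S.a 0 * V 0 2 + S.a 1 * V 1 2) + S.ζ := by
  have s0 := feasible_symm hV 1 0
  have s1 := feasible_symm hV 2 0
  have s2 := feasible_symm hV 2 1
  have h22 := hV.2.2
  simp [frobInner, Output.mat, Fin.sum_univ_three, s0, s1, s2, h22]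
  ring

theorem frobInner_mat_lift (S : Output) (y : Plane) :
    frobInner S.mat (lift y) = S.q * ‖y‖ ^ 2 + (S.a 0 * y 0 + S.a 1 * y 1) + S.ζ := by
  rw [plane_norm_sq, lift_eq]
  simp [frobInner, Output.mat, Fin.sum_univ_three]
  ring

theorem trace_lift (y : Plane) : (lift y).trace = ‖y‖ ^ 2 + 1 := by
  rw [plane_norm_sq, lift_eq]
  simp [Matrix.trace, Fin.sum_univ_three]

theorem trace_of_feasible {Imax : ℝ} {V : Mat3} (hV : V ∈ feasible Imax) :
    V.trace = V 0 0 + V 1 1 + 1 := by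
  simp [Matrix.trace, Fin.sum_univ_three, hV.2.2]

theorem isUnit_det_rowMat {S₁ S₂ : Output} (hind : LinearIndependent ℝ ![S₁.a, S₂.a]) :
    IsUnit (rowMat S₁ S₂).det := by
  rw [← Matrix.isUnit_iff_isUnit_det]
  exact Matrix.linearIndependent_rows_iff_isUnit.1 hind

theorem rowMat_mulVec (S₁ S₂ : Output) (v : Fin 2 → ℝ) :
    rowMat S₁ S₂ *ᵥ v = ![S₁.a 0 * v 0 + S₁.a 1 * v 1, S₂.a 0 * v 0 + S₂.a 1 * v 1] := by
  ext i
  fin_cases i <;> simp [rowMat, Matrix.mulVec, dotProduct, Fin.sum_univ_two]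

theorem rowMat_mulVec_vecC {S₁ S₂ : Output} (hind : LinearIndependent ℝ ![S₁.a, S₂.a]) :
    rowMat S₁ S₂ *ᵥ vecC S₁ S₂ = ![S₁.q, S₂.q] := by
  rw [vecC, Matrix.mulVec_mulVec, Matrix.mul_nonsing_inv _ (isUnit_det_rowMat hind),
    Matrix.one_mulVec]

theorem rowMat_mulVec_vecD {S₁ S₂ : Output} (hind : LinearIndependent ℝ ![S₁.a, S₂.a])
    (s : Plane) : rowMat S₁ S₂ *ᵥ vecD S₁ S₂ s = ![s 0 - S₁.ζ, s 1 - S₂.ζ] := by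
  rw [vecD, Matrix.mulVec_mulVec, Matrix.mul_nonsing_inv _ (isUnit_det_rowMat hind),
    Matrix.one_mulVec]

/-- For feasible `V` with last column `(m, 1)`, `d = m + (V₁₁ + V₂₂) c`. -/
theorem vecD_outputs {Imax : ℝ} {S₁ S₂ : Output} (hind : LinearIndependent ℝ ![S₁.a, S₂.a])
    {V : Mat3} (hV : V ∈ feasible Imax) :
    vecD S₁ S₂ (outputs S₁ S₂ V) = ![V 0 2, V 1 2] + (V 0 0 + V 1 1) • vecC S₁ S₂ := by
  have hinj := Matrix.mulVec_injective_iff_isUnit.2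
    ((Matrix.isUnit_iff_isUnit_det _).2 (isUnit_det_rowMat hind))
  apply hinj
  rw [Matrix.mulVec_add, Matrix.mulVec_smul, rowMat_mulVec_vecC hind, rowMat_mulVec_vecD hind,
    outputs_zero_eq, outputs_one_eq, frobInner_mat_of_feasible _ hV,
    frobInner_mat_of_feasible _ hV, rowMat_mulVec]
  ext i
  fin_cases i <;> simp <;> ring

/-- The quadratic is `‖d - μ c‖² = μ` expanded: a root is the squared magnitude of the current it
produces, hence nonnegative. -/
theorem mem_magnitudeRoots {S₁ S₂ : Output} {s : Plane} {μ : ℝ} :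
    μ ∈ magnitudeRoots S₁ S₂ s ↔
      (vecD S₁ S₂ s 0 - μ * vecC S₁ S₂ 0) ^ 2 + (vecD S₁ S₂ s 1 - μ * vecC S₁ S₂ 1) ^ 2 = μ := by
  simp only [magnitudeRoots, Set.mem_ofPred_eq, dotProduct, Fin.sum_univ_two]
  constructor <;> intro h <;> linarith

theorem feasible_column_sq_le {Imax : ℝ} {V : Mat3} (hV : V ∈ feasible Imax) :
    V 0 2 ^ 2 + V 1 2 ^ 2 ≤ V 0 0 + V 1 1 := by
  have h0 := feasible_quadratic_nonneg hV 1 0 (-V 0 2)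
  have h1 := feasible_quadratic_nonneg hV 0 1 (-V 1 2)
  nlinarith

/-- Intermediate values for `‖d - μ c‖² - μ` on `[0, t]`: it equals `‖d‖²` at `0` and `‖m‖² - t ≤ 0`
at `t`. -/
theorem exists_root_le_trace {Imax : ℝ} {S₁ S₂ : Output}
    (hind : LinearIndependent ℝ ![S₁.a, S₂.a]) {V : Mat3} (hV : V ∈ feasible Imax) :
    ∃ μ ∈ magnitudeRoots S₁ S₂ (outputs S₁ S₂ V), μ ≤ V 0 0 + V 1 1 := by
  set t := V 0 0 + V 1 1 with ht
  set d := vecD S₁ S₂ (outputs S₁ S₂ V) with hd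
  set c := vecC S₁ S₂ with hc
  have hcol := feasible_column_sq_le hV
  have hdm : d = ![V 0 2, V 1 2] + t • c := vecD_outputs hind hV
  have hd0 : d 0 = V 0 2 + t * c 0 := congrFun hdm 0
  have hd1 : d 1 = V 1 2 + t * c 1 := congrFun hdm 1
  have ht0 : 0 ≤ t := le_trans (by positivity) hcol
  let φ : ℝ → ℝ := fun μ => (d 0 - μ * c 0) ^ 2 + (d 1 - μ * c 1) ^ 2 - μ
  have hφ : ContinuousOn φ (Set.Icc 0 t) := by fun_prop
  have h0 : (0 : ℝ) ∈ Set.Icc (φ t) (φ 0) := by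
    constructor
    · simp only [φ, hd0, hd1]
      ring_nf
      linarith
    · simp only [φ]
      ring_nf
      positivity
  obtain ⟨μ, hμ, hroot⟩ := intermediate_value_Icc' ht0 hφ h0
  refine ⟨μ, mem_magnitudeRoots.2 ?_, hμ.2⟩
  exact sub_eq_zero.1 hroot

/-- A nonempty closed set bounded below has a least element, so the degenerate case `c = 0` needs no
separate treatment. -/
theorem exists_isExtraction {Imax : ℝ} {S₁ S₂ : Output}
    (hind : LinearIndependent ℝ ![S₁.a, S₂.a]) {V : Mat3} (hV : V ∈ feasible Imax) :
    ∃ y, IsExtraction S₁ S₂ V y := by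
  have hclosed : IsClosed (magnitudeRoots S₁ S₂ (outputs S₁ S₂ V)) :=
    isClosed_eq (by fun_prop) (by fun_prop)
  have hbdd : BddBelow (magnitudeRoots S₁ S₂ (outputs S₁ S₂ V)) := by
    refine ⟨0, fun μ hμ => ?_⟩
    rw [← mem_magnitudeRoots.1 hμ]
    positivity
  obtain ⟨μ, hμ, -⟩ := exists_root_le_trace hind hV
  exact ⟨_, _, hclosed.isLeast_csInf ⟨μ, hμ⟩ hbdd, rfl⟩

theorem IsExtraction.unique {S₁ S₂ : Output} {V : Mat3} {y y' : Plane}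
    (h : IsExtraction S₁ S₂ V y) (h' : IsExtraction S₁ S₂ V y') : y = y' := by
  obtain ⟨μ, hμ, rfl⟩ := h
  obtain ⟨μ', hμ', rfl⟩ := h'
  rw [hμ.unique hμ']

/-- As `‖y‖² = μ`, applying `P` to `y = d - μ c` gives `aᵢ · y + qᵢ ‖y‖² = sᵢ - ζᵢ`. -/
theorem IsExtraction.outputs_lift {S₁ S₂ : Output} (hind : LinearIndependent ℝ ![S₁.a, S₂.a])
    {V : Mat3} {y : Plane} (h : IsExtraction S₁ S₂ V y) :
    outputs S₁ S₂ (lift y) = outputs S₁ S₂ V := by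
  obtain ⟨μ, hμ, rfl⟩ := h
  have hroot := mem_magnitudeRoots.1 hμ.1
  set s := outputs S₁ S₂ V
  have hC := rowMat_mulVec_vecC hind
  have hD := rowMat_mulVec_vecD hind s
  rw [rowMat_mulVec] at hC hD
  have hC0 := congrFun hC 0
  have hC1 := congrFun hC 1
  have hD0 := congrFun hD 0
  have hD1 := congrFun hD 1
  simp at hC0 hC1 hD0 hD1
  apply plane_ext
  · rw [outputs_zero_eq, frobInner_mat_lift, plane_norm_sq]
    simp only [Pi.sub_apply, Pi.smul_apply, smul_eq_mul]
    rw [hroot]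
    linear_combination hD0 - μ * hC0
  · rw [outputs_one_eq, frobInner_mat_lift, plane_norm_sq]
    simp only [Pi.sub_apply, Pi.smul_apply, smul_eq_mul]
    rw [hroot]
    linear_combination hD1 - μ * hC1

theorem IsExtraction.norm_sq_le {Imax : ℝ} {S₁ S₂ : Output}
    (hind : LinearIndependent ℝ ![S₁.a, S₂.a]) {V : Mat3} (hV : V ∈ feasible Imax) {y : Plane}
    (h : IsExtraction S₁ S₂ V y) : ‖y‖ ^ 2 ≤ V 0 0 + V 1 1 := by
  obtain ⟨μ, hμ, rfl⟩ := h
  obtain ⟨ν, hν, hνt⟩ := exists_root_le_trace hind hV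
  have hroot := mem_magnitudeRoots.1 hμ.1
  rw [plane_norm_sq]
  simp only [Pi.sub_apply, Pi.smul_apply, smul_eq_mul]
  rw [hroot]
  exact (hμ.2 hν).trans hνt

/-- Equality case of `IsExtraction.norm_sq_le`: if the smallest root is `t`, then `y = d - t c = m`,
and `t = ‖m‖²` forces rank one. -/
theorem IsExtraction.eq_lift {Imax : ℝ} {S₁ S₂ : Output}
    (hind : LinearIndependent ℝ ![S₁.a, S₂.a]) {V : Mat3} (hV : V ∈ feasible Imax) {y : Plane}
    (h : IsExtraction S₁ S₂ V y) (heq : V 0 0 + V 1 1 ≤ ‖y‖ ^ 2) : V = lift y := by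
  have hle := h.norm_sq_le hind hV
  obtain ⟨μ, hμ, rfl⟩ := h
  have hroot := mem_magnitudeRoots.1 hμ.1
  have hnorm := plane_norm_sq
    (WithLp.toLp 2 (vecD S₁ S₂ (outputs S₁ S₂ V) - μ • vecC S₁ S₂))
  have hμt : μ = V 0 0 + V 1 1 := by
    have := hnorm
    simp only [Pi.sub_apply, Pi.smul_apply, smul_eq_mul] at this
    rw [hroot] at this
    linarith
  refine feasible_eq_lift hV ?_ ?_ (hnorm ▸ le_antisymm heq hle)
  · have hd : _ = V 0 2 + (V 0 0 + V 1 1) * vecC S₁ S₂ 0 := congrFun (vecD_outputs hind hV) 0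
    simp [hd, hμt]
  · have hd : _ = V 1 2 + (V 0 0 + V 1 1) * vecC S₁ S₂ 1 := congrFun (vecD_outputs hind hV) 1
    simp [hd, hμt]

theorem IsExtraction.mem_safeSet {Imax : ℝ} {S₁ S₂ : Output}
    (hind : LinearIndependent ℝ ![S₁.a, S₂.a]) {V : Mat3} (hV : V ∈ feasible Imax) {y : Plane}
    (h : IsExtraction S₁ S₂ V y) : y ∈ safeSet Imax :=
  (h.norm_sq_le hind hV).trans hV.2.1

theorem IsExtraction.objective_lift {Imax : ℝ} {S₁ S₂ : Output}
    (hind : LinearIndependent ℝ ![S₁.a, S₂.a]) {V : Mat3} (hV : V ∈ feasible Imax) {y : Plane}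
    (h : IsExtraction S₁ S₂ V y) (f₀ : Plane → ℝ) (ρ : ℝ) :
    objective S₁ S₂ f₀ ρ (lift y) = objective S₁ S₂ f₀ ρ V + ρ * (‖y‖ ^ 2 - (V 0 0 + V 1 1)) := by
  rw [objective, objective, h.outputs_lift hind, trace_lift, trace_of_feasible hV]
  ring

theorem IsExtraction.objective_lift_le {Imax : ℝ} {S₁ S₂ : Output}
    (hind : LinearIndependent ℝ ![S₁.a, S₂.a]) {V : Mat3} (hV : V ∈ feasible Imax) {y : Plane}
    (h : IsExtraction S₁ S₂ V y) (f₀ : Plane → ℝ) {ρ : ℝ} (hρ : 0 < ρ) :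
    objective S₁ S₂ f₀ ρ (lift y) ≤ objective S₁ S₂ f₀ ρ V := by
  rw [h.objective_lift hind hV]
  have := h.norm_sq_le hind hV
  nlinarith

/-! ### Convexity and smoothness of the objective -/

theorem outputs_sub (S₁ S₂ : Output) (A B : Mat3) :
    outputs S₁ S₂ (A - B) = outputs S₁ S₂ A - outputs S₁ S₂ B := by
  apply plane_ext <;>
    simp only [PiLp.sub_apply, outputs_zero_eq, outputs_one_eq, frobInner_sub_right]

theorem outputs_combo (S₁ S₂ : Output) (a b : ℝ) (A B : Mat3) :
    outputs S₁ S₂ (a • A + b • B) = a • outputs S₁ S₂ A + b • outputs S₁ S₂ B := by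
  apply plane_ext <;>
    simp only [PiLp.add_apply, PiLp.smul_apply, smul_eq_mul, outputs_zero_eq, outputs_one_eq,
      frobInner_add_right, frobInner_smul_right]

theorem continuous_outputs (S₁ S₂ : Output) : Continuous (outputs S₁ S₂) := by
  unfold outputs
  refine (PiLp.continuous_toLp 2 _).comp (continuous_pi fun i => ?_)
  fin_cases i <;> simp <;> fun_prop

theorem outputs_norm_sq_le (S₁ S₂ : Output) (A : Mat3) :
    ‖outputs S₁ S₂ A‖ ^ 2 ≤
      (frobInner S₁.mat S₁.mat + frobInner S₂.mat S₂.mat) * frobInner A A := by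
  rw [plane_norm_sq, outputs_zero_eq, outputs_one_eq, add_mul]
  exact add_le_add (frobInner_sq_le _ _) (frobInner_sq_le _ _)

/-- The first-order lower bound for a convex function, with the gradient within its domain. -/
theorem convexOn_add_inner_gradientWithin_le {D : Set Plane} {f : Plane → ℝ}
    (hf : ConvexOn ℝ D f) (hd : DifferentiableOn ℝ f D) {s u : Plane} (hs : s ∈ D) (hu : u ∈ D) :
    f s + inner ℝ (gradientWithin f D s) (u - s) ≤ f u := by
  have hmaps : Set.MapsTo (AffineMap.lineMap s u : ℝ → Plane) (Set.Icc 0 1) D := fun t ht =>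
    hf.1.lineMap_mem hs hu ht
  have hconv : ConvexOn ℝ (Set.Icc (0 : ℝ) 1) (f ∘ (AffineMap.lineMap s u : ℝ → Plane)) :=
    (hf.comp_affineMap (AffineMap.lineMap s u : ℝ →ᵃ[ℝ] Plane)).subset hmaps (convex_Icc 0 1)
  have hg := (hd s hs).hasGradientWithinAt.hasFDerivWithinAt
  have hg' : HasFDerivWithinAt f
      (InnerProductSpace.toDual ℝ Plane (gradientWithin f D s)) D
      ((AffineMap.lineMap s u : ℝ → Plane) 0) := by simpa using hg
  have hderiv := hg'.comp_hasDerivWithinAt (0 : ℝ)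
    ((AffineMap.hasDerivAt_lineMap (a := s) (b := u) (x := (0 : ℝ))).hasDerivWithinAt) hmaps
  have h := hconv.le_slope_of_hasDerivWithinAt (by simp) (by simp) one_pos hderiv
  rw [InnerProductSpace.toDual_apply_apply] at h
  simp only [slope_def_field, Function.comp_apply, AffineMap.lineMap_apply_zero,
    AffineMap.lineMap_apply_one, sub_zero, div_one] at h
  linarith

theorem mem_outputRegion {Imax : ℝ} (S₁ S₂ : Output) {W : Mat3} (hW : W ∈ feasible Imax) :
    outputs S₁ S₂ W ∈ outputRegion Imax S₁ S₂ :=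
  Set.mem_image_of_mem _ hW

theorem objective_continuousOn {Imax : ℝ} {S₁ S₂ : Output} {L : NNReal} {f₀ : Plane → ℝ}
    (hf₀ : IsConvexSmooth L (outputRegion Imax S₁ S₂) f₀) (ρ : ℝ) :
    ContinuousOn (objective S₁ S₂ f₀ ρ) (feasible Imax) := by
  refine ContinuousOn.add ?_ (Continuous.continuousOn (by fun_prop))
  exact hf₀.2.1.continuousOn.comp (continuous_outputs S₁ S₂).continuousOn
    fun W hW => mem_outputRegion S₁ S₂ hW

theorem objective_convexOn {Imax : ℝ} {S₁ S₂ : Output} {L : NNReal} {f₀ : Plane → ℝ}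
    (hf₀ : IsConvexSmooth L (outputRegion Imax S₁ S₂) f₀) (ρ : ℝ) :
    ConvexOn ℝ (feasible Imax) (objective S₁ S₂ f₀ ρ) := by
  refine ⟨feasible_convex Imax, fun A hA B hB a b ha hb hab => ?_⟩
  have h := hf₀.1.2 (mem_outputRegion S₁ S₂ hA) (mem_outputRegion S₁ S₂ hB) ha hb hab
  simp only [objective, outputs_combo, Matrix.trace_add, Matrix.trace_smul, smul_eq_mul] at h ⊢
  linarith

theorem frobInner_gradObjective (Imax : ℝ) (S₁ S₂ : Output) (f₀ : Plane → ℝ) (ρ : ℝ)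
    (W A : Mat3) :
    frobInner (gradObjective Imax S₁ S₂ f₀ ρ W) A =
      inner ℝ (gradientWithin f₀ (outputRegion Imax S₁ S₂) (outputs S₁ S₂ W)) (outputs S₁ S₂ A)
        + ρ * A.trace := by
  rw [plane_inner, outputs_zero_eq, outputs_one_eq]
  simp only [gradObjective, frobInner_add_left, frobInner_smul_left, frobInner_one]

theorem objective_add_frobInner_le {Imax : ℝ} {S₁ S₂ : Output} {L : NNReal} {f₀ : Plane → ℝ}
    (hf₀ : IsConvexSmooth L (outputRegion Imax S₁ S₂) f₀) (ρ : ℝ) {W U : Mat3}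
    (hW : W ∈ feasible Imax) (hU : U ∈ feasible Imax) :
    objective S₁ S₂ f₀ ρ W + frobInner (gradObjective Imax S₁ S₂ f₀ ρ W) (U - W) ≤
      objective S₁ S₂ f₀ ρ U := by
  have h := convexOn_add_inner_gradientWithin_le hf₀.1 hf₀.2.1 (mem_outputRegion S₁ S₂ hW)
    (mem_outputRegion S₁ S₂ hU)
  rw [frobInner_gradObjective, outputs_sub, Matrix.trace_sub, objective, objective]
  linarith

/-- A Lipschitz constant of the gradient of the objective. -/
noncomputable def smoothness (S₁ S₂ : Output) (L : NNReal) : ℝ :=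
  L * (frobInner S₁.mat S₁.mat + frobInner S₂.mat S₂.mat)

theorem smoothness_nonneg (S₁ S₂ : Output) (L : NNReal) : 0 ≤ smoothness S₁ S₂ L :=
  mul_nonneg L.2 (add_nonneg (frobInner_self_nonneg _) (frobInner_self_nonneg _))

/-- A descent lemma without integration, at the cost of the constant `S` in place of `S / 2`. The
`ρ` term is linear, so `S`, and with it the step size bound, does not depend on `ρ`. -/
theorem objective_le_add_frobInner {Imax : ℝ} {S₁ S₂ : Output} {L : NNReal} {f₀ : Plane → ℝ}
    (hf₀ : IsConvexSmooth L (outputRegion Imax S₁ S₂) f₀) (ρ : ℝ) {W V : Mat3}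
    (hW : W ∈ feasible Imax) (hV : V ∈ feasible Imax) :
    objective S₁ S₂ f₀ ρ V ≤ objective S₁ S₂ f₀ ρ W
      + frobInner (gradObjective Imax S₁ S₂ f₀ ρ W) (V - W)
      + smoothness S₁ S₂ L * frobInner (V - W) (V - W) := by
  have hsW := mem_outputRegion S₁ S₂ hW
  have hsV := mem_outputRegion S₁ S₂ hV
  -- Convexity is used at `V` towards `W`; replacing the gradient at `V` by that at `W` costs the
  -- Lipschitz term.
  have h := convexOn_add_inner_gradientWithin_le hf₀.1 hf₀.2.1 hsV hsW
  have hlip := hf₀.2.2.dist_le_mul _ hsV _ hsW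
  have hnorm := outputs_norm_sq_le S₁ S₂ (V - W)
  rw [outputs_sub] at hnorm
  rw [frobInner_gradObjective, outputs_sub, Matrix.trace_sub, objective, objective]
  set g := gradientWithin f₀ (outputRegion Imax S₁ S₂)
  set sV := outputs S₁ S₂ V
  set sW := outputs S₁ S₂ W
  rw [dist_eq_norm, dist_eq_norm] at hlip
  have hcs : inner ℝ (g sV - g sW) (sV - sW) ≤ L * ‖sV - sW‖ ^ 2 :=
    calc inner ℝ (g sV - g sW) (sV - sW) ≤ ‖g sV - g sW‖ * ‖sV - sW‖ := real_inner_le_norm _ _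
      _ ≤ (L * ‖sV - sW‖) * ‖sV - sW‖ := by gcongr
      _ = L * ‖sV - sW‖ ^ 2 := by ring
  have hL : L * ‖sV - sW‖ ^ 2 ≤ smoothness S₁ S₂ L * frobInner (V - W) (V - W) := by
    rw [smoothness, mul_assoc]
    exact mul_le_mul_of_nonneg_left hnorm L.2
  rw [inner_sub_left] at hcs
  rw [← neg_sub sV sW, inner_neg_right] at h
  linarith

/-- The basic inequality for one projected gradient step. -/
theorem IsProjection.objective_sub_le {Imax : ℝ} {S₁ S₂ : Output} {L : NNReal} {f₀ : Plane → ℝ}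
    (hf₀ : IsConvexSmooth L (outputRegion Imax S₁ S₂) f₀) {ρ α : ℝ} (hα : 0 < α) {W V U : Mat3}
    (hW : W ∈ feasible Imax) (hU : U ∈ feasible Imax)
    (h : IsProjection Imax (W - α • gradObjective Imax S₁ S₂ f₀ ρ W) V) :
    α * (objective S₁ S₂ f₀ ρ V - objective S₁ S₂ f₀ ρ U) ≤
      frobInner (V - W) (U - V) + α * smoothness S₁ S₂ L * frobInner (V - W) (V - W) := by
  have h1 := objective_le_add_frobInner hf₀ ρ hW h.1
  have h2 := objective_add_frobInner_le hf₀ ρ hW hU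
  have h3 := h.frobInner_nonneg hU
  rw [← sub_add, frobInner_add_left, frobInner_smul_left] at h3
  set G := gradObjective Imax S₁ S₂ f₀ ρ W
  have h4 : objective S₁ S₂ f₀ ρ V - objective S₁ S₂ f₀ ρ U ≤
      smoothness S₁ S₂ L * frobInner (V - W) (V - W) - frobInner G (U - V) := by
    have : frobInner G (U - V) = frobInner G (U - W) - frobInner G (V - W) := by
      rw [← frobInner_sub_right, sub_sub_sub_cancel_right]
    linarith
  have h5 := mul_le_mul_of_nonneg_left h4 hα.le
  linarith

/-! ### The minimizer -/

theorem safeSet_isCompact {Imax : ℝ} (hImax : 0 < Imax) : IsCompact (safeSet Imax) := by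
  have h : safeSet Imax = Metric.closedBall 0 Imax := by
    ext x
    simp only [safeSet, Set.mem_ofPred_eq, mem_closedBall_zero_iff]
    exact pow_le_pow_iff_left₀ (norm_nonneg x) hImax.le two_ne_zero
  rw [h]
  exact isCompact_closedBall 0 Imax

theorem exists_isMinOn_lift {Imax : ℝ} {S₁ S₂ : Output}
    (hind : LinearIndependent ℝ ![S₁.a, S₂.a]) {L : NNReal} {f₀ : Plane → ℝ}
    (hf₀ : IsConvexSmooth L (outputRegion Imax S₁ S₂) f₀) {ρ : ℝ} (hρ : 0 < ρ) :
    ∃ z ∈ safeSet Imax, IsMinOn (objective S₁ S₂ f₀ ρ) (feasible Imax) (lift z) := by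
  have hne : (feasible Imax).Nonempty :=
    ⟨lift 0, lift_mem_feasible (by simp [safeSet, sq_nonneg])⟩
  obtain ⟨W, hW, hmin⟩ := (feasible_isCompact Imax).exists_isMinOn hne
    (objective_continuousOn hf₀ ρ)
  obtain ⟨z, hz⟩ := exists_isExtraction hind hW
  exact ⟨z, hz.mem_safeSet hind hW, fun U hU =>
    (hz.objective_lift_le hind hW f₀ hρ).trans (hmin hU)⟩

/-- By convexity the midpoint of two rank-one minimizers is a minimizer. Extraction cannot improve
it, so it has rank one too, which forces the two currents to coincide. -/
theorem eq_of_isMinOn_lift {Imax : ℝ} {S₁ S₂ : Output}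
    (hind : LinearIndependent ℝ ![S₁.a, S₂.a]) {L : NNReal} {f₀ : Plane → ℝ}
    (hf₀ : IsConvexSmooth L (outputRegion Imax S₁ S₂) f₀) {ρ : ℝ} (hρ : 0 < ρ) {x z : Plane}
    (hz : z ∈ safeSet Imax) (hmin : IsMinOn (objective S₁ S₂ f₀ ρ) (feasible Imax) (lift z))
    (hx : x ∈ safeSet Imax)
    (hle : objective S₁ S₂ f₀ ρ (lift x) ≤ objective S₁ S₂ f₀ ρ (lift z)) : x = z := by
  have hxW := lift_mem_feasible hx
  have hzW := lift_mem_feasible hz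
  set V : Mat3 := (1 / 2 : ℝ) • lift x + (1 / 2 : ℝ) • lift z with hVdef
  have hV : V ∈ feasible Imax :=
    feasible_convex Imax hxW hzW (by norm_num) (by norm_num) (by norm_num)
  have hVobj : objective S₁ S₂ f₀ ρ V ≤ objective S₁ S₂ f₀ ρ (lift z) := by
    have h := (objective_convexOn hf₀ ρ).2 hxW hzW (by norm_num : (0 : ℝ) ≤ 1 / 2)
      (by norm_num : (0 : ℝ) ≤ 1 / 2) (by norm_num)
    simp only [smul_eq_mul, ← hVdef] at h
    linarith
  obtain ⟨y, hy⟩ := exists_isExtraction hind hV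
  have hyobj := hy.objective_lift hind hV f₀ ρ
  have hymin : objective S₁ S₂ f₀ ρ (lift z) ≤ objective S₁ S₂ f₀ ρ (lift y) :=
    hmin (lift_mem_feasible (hy.mem_safeSet hind hV))
  have hnorm : 0 ≤ ‖y‖ ^ 2 - (V 0 0 + V 1 1) :=
    nonneg_of_mul_nonneg_right (by linarith) hρ
  have hVy := hy.eq_lift hind hV (by linarith)
  have e00 : (1 / 2 : ℝ) * x 0 ^ 2 + 1 / 2 * z 0 ^ 2 = y 0 ^ 2 := by
    have := congrFun (congrFun hVy 0) 0
    simpa [hVdef, lift_eq] using this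
  have e11 : (1 / 2 : ℝ) * x 1 ^ 2 + 1 / 2 * z 1 ^ 2 = y 1 ^ 2 := by
    have := congrFun (congrFun hVy 1) 1
    simpa [hVdef, lift_eq] using this
  have e02 : (1 / 2 : ℝ) * x 0 + 1 / 2 * z 0 = y 0 := by
    have := congrFun (congrFun hVy 0) 2
    simpa [hVdef, lift_eq] using this
  have e12 : (1 / 2 : ℝ) * x 1 + 1 / 2 * z 1 = y 1 := by
    have := congrFun (congrFun hVy 1) 2
    simpa [hVdef, lift_eq] using this
  -- In each coordinate the mean of the squares equals the square of the mean, so `(x i - z i) ^ 2 =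
  -- 0`.
  rw [← e02] at e00
  rw [← e12] at e11
  apply plane_ext
  · exact sub_eq_zero.1 (pow_eq_zero_iff two_ne_zero |>.1 (by linarith : (x 0 - z 0) ^ 2 = 0))
  · exact sub_eq_zero.1 (pow_eq_zero_iff two_ne_zero |>.1 (by linarith : (x 1 - z 1) ^ 2 = 0))

/-- On a compact set, points whose value is close to the minimum are close to a unique minimizer. -/
theorem exists_sublevel_subset_ball {X : Type*} [PseudoMetricSpace X] {K : Set X}
    (hK : IsCompact K) {F : X → ℝ} (hF : ContinuousOn F K) {z : X}
    (hz : ∀ x ∈ K, F x ≤ F z → x = z) {ε : ℝ} (hε : 0 < ε) :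
    ∃ η > 0, ∀ x ∈ K, F x < F z + η → dist x z < ε := by
  have hK' : IsCompact (K ∩ {x | ε ≤ dist x z}) :=
    hK.inter_right (isClosed_le continuous_const (continuous_id.dist continuous_const))
  rcases (K ∩ {x | ε ≤ dist x z}).eq_empty_or_nonempty with hemp | hne
  · refine ⟨1, one_pos, fun x hx _ => ?_⟩
    by_contra! hcon
    exact hemp.subset ⟨hx, hcon⟩
  · obtain ⟨x₀, hx₀, hmin⟩ := hK'.exists_isMinOn hne (hF.mono Set.inter_subset_left)
    refine ⟨F x₀ - F z, ?_, fun x hx hlt => ?_⟩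
    · by_contra! hcon
      have hx₀z := hz x₀ hx₀.1 (by linarith)
      have hdist : ε ≤ dist x₀ z := hx₀.2
      rw [hx₀z, dist_self] at hdist
      linarith
    · by_contra! hcon
      have : F x₀ ≤ F x := hmin ⟨hx, hcon⟩
      linarith

/-! ### The iteration -/

theorem exists_isStep {Imax : ℝ} {S₁ S₂ : Output} (hind : LinearIndependent ℝ ![S₁.a, S₂.a])
    (f₀ : Plane → ℝ) (ρ α : ℝ) (x : Plane) : ∃ y, IsStep Imax S₁ S₂ f₀ ρ α x y := by
  obtain ⟨V, hV⟩ := exists_isProjection (Imax := Imax)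
    (lift x - α • gradObjective Imax S₁ S₂ f₀ ρ (lift x))
  obtain ⟨y, hy⟩ := exists_isExtraction hind hV.1
  exact ⟨y, V, hV, hy⟩

theorem IsStep.unique {Imax : ℝ} {S₁ S₂ : Output} {f₀ : Plane → ℝ} {ρ α : ℝ} {x y y' : Plane}
    (h : IsStep Imax S₁ S₂ f₀ ρ α x y) (h' : IsStep Imax S₁ S₂ f₀ ρ α x y') : y = y' := by
  obtain ⟨V, hV, hy⟩ := h
  obtain ⟨V', hV', hy'⟩ := h'
  obtain rfl := hV.unique hV'
  exact hy.unique hy'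

theorem IsStep.mem_safeSet {Imax : ℝ} {S₁ S₂ : Output}
    (hind : LinearIndependent ℝ ![S₁.a, S₂.a]) {f₀ : Plane → ℝ} {ρ α : ℝ} {x y : Plane}
    (h : IsStep Imax S₁ S₂ f₀ ρ α x y) : y ∈ safeSet Imax := by
  obtain ⟨V, hV, hy⟩ := h
  exact hy.mem_safeSet hind hV.1

/-- A total functional relation has exactly one trajectory from each point. -/
theorem existsUnique_isRun {step : Plane → Plane → Prop} (hex : ∀ x, ∃ y, step x y)
    (huniq : ∀ x y y', step x y → step x y' → y = y') (x₀ : Plane) :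
    ∃! x, IsRun step x₀ x := by
  choose φ hφ using hex
  refine ⟨fun k => φ^[k] x₀, ⟨rfl, fun k => ?_⟩, fun x hx => ?_⟩
  · simp only [Function.iterate_succ_apply']
    exact hφ _
  · funext k
    induction k with
    | zero => exact hx.1
    | succ k ih =>
      rw [Function.iterate_succ_apply', ← ih]
      exact huniq _ _ _ (hx.2 k) (hφ _)

theorem IsRun.mem_safeSet {Imax : ℝ} {S₁ S₂ : Output}
    (hind : LinearIndependent ℝ ![S₁.a, S₂.a]) {f₀ : Plane → ℝ} {ρ α : ℝ} {x₀ : Plane}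
    {x : ℕ → Plane} (hx₀ : x₀ ∈ safeSet Imax) (h : IsRun (IsStep Imax S₁ S₂ f₀ ρ α) x₀ x)
    (k : ℕ) : x k ∈ safeSet Imax := by
  cases k with
  | zero => exact h.1 ▸ hx₀
  | succ k => exact (h.2 k).mem_safeSet hind

/-- Every step from a safe current decreases the objective by a multiple of the squared length `δ`
of the projected gradient step, and the new objective value is nearly optimal if `δ` is small. -/
theorem IsStep.objective_bounds {Imax : ℝ} {S₁ S₂ : Output}
    (hind : LinearIndependent ℝ ![S₁.a, S₂.a]) {L : NNReal} {f₀ : Plane → ℝ}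
    (hf₀ : IsConvexSmooth L (outputRegion Imax S₁ S₂) f₀) {ρ α : ℝ} (hρ : 0 < ρ) (hα : 0 < α)
    {B : ℝ} {z : Plane} (hz : z ∈ safeSet Imax)
    (hB : ∀ V ∈ feasible Imax, frobInner (V - lift z) (V - lift z) ≤ B)
    {x y : Plane} (hx : x ∈ safeSet Imax) (h : IsStep Imax S₁ S₂ f₀ ρ α x y) :
    ∃ δ : ℝ, 0 ≤ δ ∧
      (1 - α * smoothness S₁ S₂ L) * δ ≤
        α * (objective S₁ S₂ f₀ ρ (lift x) - objective S₁ S₂ f₀ ρ (lift y)) ∧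
      α * (objective S₁ S₂ f₀ ρ (lift y) - objective S₁ S₂ f₀ ρ (lift z)) ≤
        √(δ * B) + α * smoothness S₁ S₂ L * δ := by
  obtain ⟨V, hV, hy⟩ := h
  have hxW := lift_mem_feasible hx
  have hyV := mul_le_mul_of_nonneg_left (hy.objective_lift_le hind hV.1 f₀ hρ) hα.le
  refine ⟨frobInner (V - lift x) (V - lift x), frobInner_self_nonneg _, ?_, ?_⟩
  -- Comparison with the current iterate yields the decrease; comparison with the minimizer below
  -- yields the optimality gap.
  · have h1 := hV.objective_sub_le hf₀ hα hxW hxW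
    have h2 : frobInner (V - lift x) (lift x - V) = -frobInner (V - lift x) (V - lift x) := by
      simp only [frobInner_sub_right]
      ring
    linarith
  · have h1 := hV.objective_sub_le hf₀ hα hxW (lift_mem_feasible hz)
    have h2 : frobInner (V - lift x) (lift z - V) ≤
        √(frobInner (V - lift x) (V - lift x) * B) := by
      apply Real.le_sqrt_of_sq_le
      refine (frobInner_sq_le _ _).trans
        (mul_le_mul_of_nonneg_left ?_ (frobInner_self_nonneg _))
      have h3 : frobInner (lift z - V) (lift z - V) = frobInner (V - lift z) (V - lift z) := by
        simp only [frobInner_sub_right, frobInner_sub_left]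
        ring
      rw [h3]
      exact hB V hV.1
    linarith

/-- A sequence of values that obeys the bounds of `IsStep.objective_bounds` tends to the optimum. -/
theorem tendsto_of_descent_bounds {F : ℕ → ℝ} {F₀ α S B : ℝ} (hα : 0 < α) (hαS : α * S < 1)
    (hF₀ : ∀ k, F₀ ≤ F k)
    (h : ∀ k, ∃ δ : ℝ, 0 ≤ δ ∧ (1 - α * S) * δ ≤ α * (F k - F (k + 1)) ∧
      α * (F (k + 1) - F₀) ≤ √(δ * B) + α * S * δ) :
    Antitone F ∧ Filter.Tendsto F Filter.atTop (nhds F₀) := by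
  choose δ hδ0 hδ hbound using h
  have hpos : 0 < 1 - α * S := by linarith
  have hanti : Antitone F := antitone_nat_of_succ_le fun k => by
    have : 0 ≤ F k - F (k + 1) :=
      nonneg_of_mul_nonneg_right ((mul_nonneg hpos.le (hδ0 k)).trans (hδ k)) hα
    linarith
  refine ⟨hanti, ?_⟩
  have hconv : Filter.Tendsto F Filter.atTop (nhds (⨅ k, F k)) :=
    tendsto_atTop_ciInf hanti ⟨F₀, by rintro _ ⟨k, rfl⟩; exact hF₀ k⟩
  have hsucc := hconv.comp (Filter.tendsto_add_atTop_nat 1)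
  -- Consecutive differences of the convergent sequence `F` tend to zero and dominate `δ`.
  have hδt : Filter.Tendsto δ Filter.atTop (nhds 0) := by
    have hup : Filter.Tendsto (fun k => α * (F k - F (k + 1)) / (1 - α * S)) Filter.atTop
        (nhds 0) := by
      have := ((hconv.sub hsucc).const_mul α).div_const (1 - α * S)
      simpa using this
    refine squeeze_zero hδ0 (fun k => ?_) hup
    rw [le_div_iff₀ hpos]
    linarith [hδ k]
  have hgap : Filter.Tendsto (fun k => F₀ + (√(δ k * B) + α * S * δ k) / α) Filter.atTop
      (nhds F₀) := by
    have h1 : Filter.Tendsto (fun k => √(δ k * B)) Filter.atTop (nhds 0) := by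
      have := (hδt.mul_const B).sqrt
      simpa using this
    have := ((h1.add (hδt.const_mul (α * S))).div_const α).const_add F₀
    simpa using this
  refine (Filter.tendsto_add_atTop_iff_nat 1).1
    (tendsto_of_tendsto_of_tendsto_of_le_of_le tendsto_const_nhds hgap (fun k => hF₀ _) fun k => ?_)
  have : F (k + 1) - F₀ ≤ (√(δ k * B) + α * S * δ k) / α := by
    rw [le_div_iff₀ hα]
    linarith [hbound k]
  simp only
  linarith

end SafeConverter

/-! ### Convergence and asymptotic stability -/

open SafeConverter

theorem theorem2 (Imax : ℝ) (hImax : 0 < Imax) (S₁ S₂ : SafeConverter.Output)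
    (hind : LinearIndependent ℝ ![S₁.a, S₂.a]) (L : NNReal) (f₀ : SafeConverter.Plane → ℝ)
    (hf₀ : SafeConverter.IsConvexSmooth L (SafeConverter.outputRegion Imax S₁ S₂) f₀) :
    ∃ α₀ : ℝ, 0 < α₀ ∧ ∀ ρ : ℝ, 0 < ρ →
      ∃ z ∈ SafeConverter.safeSet Imax,
        IsMinOn (SafeConverter.objective S₁ S₂ f₀ ρ) (SafeConverter.feasible Imax)
          (SafeConverter.lift z) ∧
        IsMinOn (fun x => SafeConverter.objective S₁ S₂ f₀ ρ (SafeConverter.lift x))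
          (SafeConverter.safeSet Imax) z ∧
        ∀ α : ℝ, 0 < α → α < α₀ →
          (∀ x₀ ∈ SafeConverter.safeSet Imax,
            ∃! x, SafeConverter.IsRun (SafeConverter.IsStep Imax S₁ S₂ f₀ ρ α) x₀ x) ∧
          (∀ x₀ ∈ SafeConverter.safeSet Imax, ∀ x,
            SafeConverter.IsRun (SafeConverter.IsStep Imax S₁ S₂ f₀ ρ α) x₀ x →
              (∀ k, x k ∈ SafeConverter.safeSet Imax) ∧
              Filter.Tendsto x Filter.atTop (nhds z)) ∧
          SafeConverter.IsAsymptoticallyStable (SafeConverter.safeSet Imax)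
            (SafeConverter.IsStep Imax S₁ S₂ f₀ ρ α) z := by
  have hS := smoothness_nonneg S₁ S₂ L
  -- Only `α S < 1` is needed; the `+ 1` covers `S = 0`.
  refine ⟨1 / (smoothness S₁ S₂ L + 1), by positivity, fun ρ hρ => ?_⟩
  obtain ⟨z, hz, hmin⟩ := exists_isMinOn_lift hind hf₀ hρ
  have hminI : IsMinOn (fun x => objective S₁ S₂ f₀ ρ (lift x)) (safeSet Imax) z :=
    fun x hx => hmin (lift_mem_feasible hx)
  refine ⟨z, hz, hmin, hminI, fun α hα hα₀ => ?_⟩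
  have hαS : α * smoothness S₁ S₂ L < 1 := by
    rw [lt_div_iff₀ (by linarith)] at hα₀
    linarith
  obtain ⟨B, hB⟩ := ((feasible_isCompact Imax).image
    (continuous_frobInner_self_sub (lift z))).bddAbove
  have hB' : ∀ V ∈ feasible Imax, frobInner (V - lift z) (V - lift z) ≤ B := fun V hV =>
    hB (Set.mem_image_of_mem _ hV)
  have hF : ContinuousOn (fun x => objective S₁ S₂ f₀ ρ (lift x)) (safeSet Imax) :=
    (objective_continuousOn hf₀ ρ).comp continuous_lift.continuousOn
      fun x hx => lift_mem_feasible hx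
  have hsub {ε : ℝ} (hε : 0 < ε) := exists_sublevel_subset_ball (safeSet_isCompact hImax) hF
    (fun x hx hle => eq_of_isMinOn_lift hind hf₀ hρ hz hmin hx hle) hε
  have hrun : ∀ x₀ ∈ safeSet Imax, ∀ x, IsRun (IsStep Imax S₁ S₂ f₀ ρ α) x₀ x →
      Antitone (fun k => objective S₁ S₂ f₀ ρ (lift (x k))) ∧
      Filter.Tendsto (fun k => objective S₁ S₂ f₀ ρ (lift (x k))) Filter.atTop
        (nhds (objective S₁ S₂ f₀ ρ (lift z))) := fun x₀ hx₀ x hx =>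
    tendsto_of_descent_bounds hα hαS (fun k => hminI (hx.mem_safeSet hind hx₀ k)) fun k =>
      (hx.2 k).objective_bounds hind hf₀ hρ hα hz hB' (hx.mem_safeSet hind hx₀ k)
  have hlim : ∀ x₀ ∈ safeSet Imax, ∀ x, IsRun (IsStep Imax S₁ S₂ f₀ ρ α) x₀ x →
      Filter.Tendsto x Filter.atTop (nhds z) := by
    intro x₀ hx₀ x hx
    rw [Metric.tendsto_nhds]
    intro ε hε
    obtain ⟨η, hη, hball⟩ := hsub hε
    filter_upwards [(hrun x₀ hx₀ x hx).2.eventually_lt_const (lt_add_of_pos_right _ hη)] with k hk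
    exact hball _ (hx.mem_safeSet hind hx₀ k) hk
  refine ⟨fun x₀ _ => existsUnique_isRun (exists_isStep hind f₀ ρ α)
    (fun _ _ _ h h' => h.unique h') x₀,
    fun x₀ hx₀ x hx => ⟨hx.mem_safeSet hind hx₀, hlim x₀ hx₀ x hx⟩, ?_, ?_, ?_⟩
  -- The step from `z` does not raise the minimal value, so by uniqueness it returns to `z`.
  · obtain ⟨y, hy⟩ := exists_isStep (Imax := Imax) hind f₀ ρ α z
    obtain ⟨δ, hδ0, hδ, -⟩ := hy.objective_bounds hind hf₀ hρ hα hz hB' hz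
    have hle : 0 ≤ objective S₁ S₂ f₀ ρ (lift z) - objective S₁ S₂ f₀ ρ (lift y) :=
      nonneg_of_mul_nonneg_right ((mul_nonneg (by linarith) hδ0).trans hδ) hα
    have hyz : y = z :=
      eq_of_isMinOn_lift hind hf₀ hρ hz hmin (hy.mem_safeSet hind) (by linarith)
    rwa [hyz] at hy
  · intro ε hε
    obtain ⟨η, hη, hball⟩ := hsub hε
    -- Starting points near `z` lie in a sublevel set contained in the `ε`-ball, and runs never
    -- leave sublevel sets.
    obtain ⟨δ, hδ, hnear⟩ := Metric.continuousWithinAt_iff.1 (hF z hz) η hη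
    refine ⟨δ, hδ, fun x₀ hx₀ hdist x hx k => hball _ (hx.mem_safeSet hind hx₀ k) ?_⟩
    have h0 := (abs_lt.1 (Real.dist_eq _ _ ▸ hnear hx₀ hdist)).2
    have hk := (hrun x₀ hx₀ x hx).1 (Nat.zero_le k)
    simp only [hx.1] at hk
    linarith
  -- Attraction is global on the safe set, so any radius serves.
  · exact ⟨1, one_pos, fun x₀ hx₀ _ => hlim x₀ hx₀⟩
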